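/- Whipple's summation formula (general, possibly non-terminating case). For $x\in\mathbb{C}$ and $n\in\mathbb{Z}_{\ge 0}$ let $(x)_n=x(x+1)\cdots(x+n-1)$, $(x)_0=1$. Let $a,b,c\in\mathbb{C}$ with $\operatorname{Re}(b+c)>1$, and suppose that neither $b$ nor $c$ is one of the integers $0,-1,-2,\dots$. Then the series $$ {}_3F_2\!\left({a,\;1-a,\;\tfrac{b+c-1}{2}\atop b,\;c};\,1\right)=\sum_{n=0}^{\infty}\frac{(a)_n\,(1-a)_n\,\left(\tfrac{b+c-1}{2}\right)_n}{n!\,(b)_n\,(c)_n} $$ converges absolutely, and its sum equals $$ \frac{4\pi\cdot 2^{-(b+c)}\,\Gamma(b)\,\Gamma(c)}{\Gamma\!\left(\frac{b+a}{2}\right)\Gamma\!\left(\frac{b+1-a}{2}\right)\Gamma\!\left(\frac{c+a}{2}\right)\Gamma\!\left(\frac{c+1-a}{2}\right)}, $$ where $1/\Gamma$ is understood as the entire function that vanishes at $0,-1,-2,\dots$. -/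

import Mathlib

/-- The `n`-th term `(a₁)ₙ⋯(aₚ)ₙ / (n! (b₁)ₙ⋯(b_q)ₙ) * zⁿ` of the generalized hypergeometric series
with upper parameters `as` and lower parameters `bs`; here `(a)ₙ = a (a + 1) ⋯ (a + n - 1)` is the
rising factorial, i.e. the value at `a` of `ascPochhammer ℂ n`. -/
noncomputable def hypergeometricTerm (as bs : List ℂ) (z : ℂ) (n : ℕ) : ℂ :=
  (as.map fun a => (ascPochhammer ℂ n).eval a).prod /
    ((n.factorial : ℂ) * (bs.map fun b => (ascPochhammer ℂ n).eval b).prod) * z ^ n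

/-- The sum of the generalized hypergeometric series `ₚF_q(as; bs; z)`. -/
noncomputable def generalizedHypergeometric (as bs : List ℂ) (z : ℂ) : ℂ :=
  ∑' n : ℕ, hypergeometricTerm as bs z n

/-! The sum `F(b, c)` of Whipple's series satisfies the contiguous relation
`F(b, c) = (b + a) (b + 1 - a) / (b (b + 1)) * F(b + 2, c)`: termwise the two sides differ by the
forward difference of a sequence that vanishes at `0` and tends to `0`. By the symmetry
`F(b, c) = F(c, b)` the same holds in `c`, so `F(b, c)` equals `F(b + 2N, c + 2N)` times a quotient
of rising factorials. As `N → ∞`, dominated convergence shows that `F(b + 2N, c + 2N)` tends to its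
first term `1`, while `(x)ₙ ~ n ^ (x - 1) * n! / Γ(x)` and Legendre's duplication formula turn the
quotient of rising factorials into the stated quotient of Gamma values. The same asymptotics of the
rising factorial give the convergence of the series.
-/

open Filter Topology Complex

theorem ne_neg_natCast_of_re_pos {x : ℂ} (hx : 0 < x.re) (k : ℕ) : x ≠ -k := by
  rintro rfl
  simp only [neg_re, natCast_re, Left.neg_pos_iff] at hx
  exact hx.not_ge k.cast_nonneg

theorem add_natCast_ne_zero {x : ℂ} (hx : ∀ k : ℕ, x ≠ -k) (k : ℕ) : x + k ≠ 0 :=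
  fun h => hx k (eq_neg_of_add_eq_zero_left h)

theorem add_natCast_ne_neg_natCast {x : ℂ} (hx : ∀ k : ℕ, x ≠ -k) (m k : ℕ) : x + m ≠ -k :=
  fun h => hx (m + k) (by push_cast; linear_combination h)

section Pochhammer

theorem eval_ascPochhammer_eq_prod_range {R : Type*} [CommSemiring R] (n : ℕ) (x : R) :
    (ascPochhammer R n).eval x = ∏ j ∈ Finset.range n, (x + j) := by
  induction n with
  | zero => simp
  | succ n ih => rw [ascPochhammer_succ_eval, ih, Finset.prod_range_succ]

theorem eval_ascPochhammer_ne_zero {x : ℂ} (hx : ∀ k : ℕ, x ≠ -k) (n : ℕ) :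
    (ascPochhammer ℂ n).eval x ≠ 0 := by
  rw [Ne, ascPochhammer_eval_eq_zero_iff]
  rintro ⟨k, -, hk⟩
  exact hx k (by rw [hk, neg_neg])

theorem mul_eval_ascPochhammer_add_one {R : Type*} [CommSemiring R] (n : ℕ) (x : R) :
    x * (ascPochhammer R n).eval (x + 1) = (ascPochhammer R n).eval x * (x + n) := by
  rw [← ascPochhammer_succ_eval, ascPochhammer_succ_left]
  simp

/-- The rising factorial `(x)ₙ` divided by its order of growth `n ^ (x - 1) * n!`. -/
noncomputable def normalizedAscPochhammer (x : ℂ) (n : ℕ) : ℂ :=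
  (ascPochhammer ℂ n).eval x / ((n : ℂ) ^ (x - 1) * n.factorial)

theorem eval_ascPochhammer_eq_normalized_mul (x : ℂ) {n : ℕ} (hn : n ≠ 0) :
    (ascPochhammer ℂ n).eval x =
      normalizedAscPochhammer x n * ((n : ℂ) ^ x * (n.factorial / n)) := by
  have hn' : (n : ℂ) ≠ 0 := Nat.cast_ne_zero.2 hn
  have hfact : (n.factorial : ℂ) ≠ 0 := Nat.cast_ne_zero.2 n.factorial_ne_zero
  have hpow : (n : ℂ) ^ x ≠ 0 := cpow_ne_zero_iff.2 (Or.inl hn')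
  rw [normalizedAscPochhammer, cpow_sub _ _ hn', cpow_one]
  field_simp

theorem normalizedAscPochhammer_eq_inv_GammaSeq_mul {x : ℂ} {n : ℕ} (hn : n ≠ 0)
    (hxn : x + n ≠ 0) :
    normalizedAscPochhammer x n = (GammaSeq x n)⁻¹ * (n / (n + x)) := by
  have hn' : (n : ℂ) ≠ 0 := Nat.cast_ne_zero.2 hn
  rw [normalizedAscPochhammer, GammaSeq, ← eval_ascPochhammer_eq_prod_range,
    ascPochhammer_succ_eval, cpow_sub _ _ hn', cpow_one, add_comm (n : ℂ) x]
  field_simp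

theorem tendsto_normalizedAscPochhammer (x : ℂ) :
    Tendsto (normalizedAscPochhammer x) atTop (𝓝 (Gamma x)⁻¹) := by
  by_cases hx : ∀ k : ℕ, x ≠ -k
  · have hlim := ((GammaSeq_tendsto_Gamma x).inv₀ (Gamma_ne_zero hx)).mul
      (tendsto_natCast_div_add_atTop x)
    rw [mul_one] at hlim
    refine hlim.congr' ?_
    filter_upwards [eventually_ne_atTop 0] with n hn
    exact (normalizedAscPochhammer_eq_inv_GammaSeq_mul hn
      (add_natCast_ne_zero hx n)).symm
  · push Not at hx
    obtain ⟨k, rfl⟩ := hx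
    rw [Gamma_neg_nat_eq_zero, inv_zero]
    refine tendsto_const_nhds.congr' ?_
    filter_upwards [eventually_gt_atTop k] with n hn
    rw [normalizedAscPochhammer, ascPochhammer_eval_neg_coe_nat_of_lt hn, zero_div]

/-- The product `(a₁)ₙ⋯(aₚ)ₙ` of the rising factorials of a list of parameters, which is the
numerator of a hypergeometric term and, for the list `1 :: bs`, its denominator. -/
noncomputable def ascPochhammerProd (as : List ℂ) (n : ℕ) : ℂ :=
  (as.map fun a => (ascPochhammer ℂ n).eval a).prod

theorem ascPochhammerProd_eq_normalized_mul (as : List ℂ) {n : ℕ} (hn : n ≠ 0) :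
    ascPochhammerProd as n = (as.map (normalizedAscPochhammer · n)).prod *
      ((n : ℂ) ^ as.sum * (n.factorial / n) ^ as.length) := by
  unfold ascPochhammerProd
  induction as with
  | nil => simp
  | cons a as ih =>
    simp only [List.map_cons, List.prod_cons, List.sum_cons, List.length_cons, ih, pow_succ,
      cpow_add _ _ (Nat.cast_ne_zero.2 hn), eval_ascPochhammer_eq_normalized_mul a hn]
    ring

theorem cpow_mul_ascPochhammerProd_div {as bs : List ℂ} (hlen : as.length = bs.length) {n : ℕ}
    (hn : n ≠ 0) :
    (n : ℂ) ^ (bs.sum - as.sum) * (ascPochhammerProd as n / ascPochhammerProd bs n) =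
      (as.map (normalizedAscPochhammer · n)).prod /
        (bs.map (normalizedAscPochhammer · n)).prod := by
  have hn' : (n : ℂ) ≠ 0 := Nat.cast_ne_zero.2 hn
  have hfact : (n.factorial : ℂ) / n ≠ 0 :=
    div_ne_zero (Nat.cast_ne_zero.2 n.factorial_ne_zero) hn'
  have hpow (x : ℂ) : (n : ℂ) ^ x ≠ 0 := cpow_ne_zero_iff.2 (Or.inl hn')
  have has := hpow as.sum
  have hbs := hpow bs.sum
  rw [ascPochhammerProd_eq_normalized_mul as hn, ascPochhammerProd_eq_normalized_mul bs hn, hlen,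
    cpow_sub _ _ hn', mul_div_mul_comm, mul_div_mul_right _ _ (pow_ne_zero _ hfact)]
  field_simp

theorem tendsto_ascPochhammerProd_div {as bs : List ℂ} (hlen : as.length = bs.length)
    (hbs : ∀ b ∈ bs, ∀ k : ℕ, b ≠ -k) :
    Tendsto (fun n : ℕ => (n : ℂ) ^ (bs.sum - as.sum) *
        (ascPochhammerProd as n / ascPochhammerProd bs n))
      atTop (𝓝 ((bs.map Gamma).prod / (as.map Gamma).prod)) := by
  have hprod (cs : List ℂ) : Tendsto (fun n => (cs.map (normalizedAscPochhammer · n)).prod)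
      atTop (𝓝 ((cs.map Gamma).prod)⁻¹) := by
    rw [List.prod_inv, List.map_map]
    exact tendsto_list_prod cs fun x _ => tendsto_normalizedAscPochhammer x
  have hGamma : (bs.map Gamma).prod ≠ 0 := by
    rw [Ne, List.prod_eq_zero_iff, List.mem_map]
    rintro ⟨b, hb, hb0⟩
    exact Gamma_ne_zero (hbs b hb) hb0
  have hlim := (hprod as).div (hprod bs) (inv_ne_zero hGamma)
  rw [inv_div_inv] at hlim
  refine hlim.congr' ?_
  filter_upwards [eventually_ne_atTop 0] with n hn
  exact (cpow_mul_ascPochhammerProd_div hlen hn).symm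

end Pochhammer

section HypergeometricTerm

theorem hypergeometricTerm_one_eq_div (as bs : List ℂ) (n : ℕ) :
    hypergeometricTerm as bs 1 n = ascPochhammerProd as n / ascPochhammerProd (1 :: bs) n := by
  simp [hypergeometricTerm, ascPochhammerProd, ascPochhammer_eval_one]

theorem hypergeometricTerm_succ (as bs : List ℂ) (z : ℂ) (n : ℕ) :
    hypergeometricTerm as bs z (n + 1) =
      (as.map (· + (n : ℂ))).prod / ((n + 1) * (bs.map (· + (n : ℂ))).prod) * z *
        hypergeometricTerm as bs z n := by
  simp only [hypergeometricTerm, ascPochhammer_succ_eval, List.prod_map_mul, Nat.factorial_succ,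
    Nat.cast_mul, Nat.cast_succ, pow_succ, div_eq_mul_inv, mul_inv]
  ring

theorem tendsto_cpow_mul_hypergeometricTerm_one {as bs : List ℂ}
    (hlen : as.length = bs.length + 1) (hbs : ∀ b ∈ bs, ∀ k : ℕ, b ≠ -k) :
    Tendsto (fun n : ℕ => (n : ℂ) ^ (1 + bs.sum - as.sum) * hypergeometricTerm as bs 1 n)
      atTop (𝓝 ((bs.map Gamma).prod / (as.map Gamma).prod)) := by
  have hone : ∀ k : ℕ, (1 : ℂ) ≠ -k := ne_neg_natCast_of_re_pos (by simp)
  simpa [hypergeometricTerm_one_eq_div] using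
    tendsto_ascPochhammerProd_div (bs := 1 :: bs) hlen (List.forall_mem_cons.2 ⟨hone, hbs⟩)

theorem isBigO_hypergeometricTerm_one {as bs : List ℂ}
    (hlen : as.length = bs.length + 1) (hbs : ∀ b ∈ bs, ∀ k : ℕ, b ≠ -k) :
    hypergeometricTerm as bs 1 =O[atTop]
      fun n : ℕ => (n : ℝ) ^ (as.sum.re - bs.sum.re - 1) := by
  have hpow : (fun n : ℕ => (n : ℂ) ^ (as.sum - bs.sum - 1)) =O[atTop]
      fun n : ℕ => (n : ℝ) ^ (as.sum.re - bs.sum.re - 1) := by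
    refine .of_norm_eventuallyLE ?_
    filter_upwards [eventually_gt_atTop 0] with n hn
    simp [norm_natCast_cpow_of_pos hn]
  have hmul := ((tendsto_cpow_mul_hypergeometricTerm_one hlen hbs).isBigO_one ℝ).mul hpow
  refine hmul.congr' ?_ (by simp)
  filter_upwards [eventually_ne_atTop 0] with n hn
  rw [mul_right_comm, ← cpow_add _ _ (Nat.cast_ne_zero.2 hn),
    show 1 + bs.sum - as.sum + (as.sum - bs.sum - 1) = 0 by ring, cpow_zero, one_mul]

theorem summable_hypergeometricTerm_one {as bs : List ℂ} (hlen : as.length = bs.length + 1)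
    (hbs : ∀ b ∈ bs, ∀ k : ℕ, b ≠ -k) (hre : as.sum.re < bs.sum.re) :
    Summable (hypergeometricTerm as bs 1) :=
  summable_of_isBigO_nat (Real.summable_nat_rpow.2 (by linarith))
    (isBigO_hypergeometricTerm_one hlen hbs)

theorem tendsto_natCast_mul_hypergeometricTerm_one {as bs : List ℂ}
    (hlen : as.length = bs.length + 1) (hbs : ∀ b ∈ bs, ∀ k : ℕ, b ≠ -k)
    (hre : as.sum.re < bs.sum.re) :
    Tendsto (fun n : ℕ => (n : ℂ) * hypergeometricTerm as bs 1 n) atTop (𝓝 0) := by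
  have hcast : (fun n : ℕ => (n : ℂ)) =O[atTop] fun n : ℕ => (n : ℝ) :=
    .of_norm_eventuallyLE (by simp [EventuallyLE.rfl])
  refine (hcast.mul (isBigO_hypergeometricTerm_one hlen hbs)).trans_tendsto ?_
  have hlim := (tendsto_rpow_neg_atTop (sub_pos.2 hre)).comp tendsto_natCast_atTop_atTop
  refine hlim.congr' ?_
  filter_upwards [eventually_ne_atTop 0] with n hn
  have hn' : (n : ℝ) ≠ 0 := Nat.cast_ne_zero.2 hn
  rw [Function.comp_apply, Real.rpow_sub_one hn', mul_div_cancel₀ _ hn', neg_sub]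

end HypergeometricTerm

section LargeLowerParameters

theorem norm_half_add_sub_one_mul_le {b c : ℂ} {r : ℝ} (hr : 1 / 2 ≤ r) (hb : r ≤ b.re)
    (hc : r ≤ c.re) : ‖(b + c - 1) / 2‖ * r ≤ ‖b‖ * ‖c‖ := by
  have hb' : r ≤ ‖b‖ := hb.trans (re_le_norm b)
  have hc' : r ≤ ‖c‖ := hc.trans (re_le_norm c)
  have hsub : ‖b - 1‖ ≤ ‖b‖ := by
    rw [← sq_le_sq₀ (norm_nonneg _) (norm_nonneg _), Complex.sq_norm, Complex.sq_norm,
      normSq_apply, normSq_apply]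
    simp only [sub_re, one_re, sub_im, one_im]
    linarith
  have hhalf : ‖(b + c - 1) / 2‖ ≤ (‖b‖ + ‖c‖) / 2 := by
    rw [add_sub_right_comm, norm_div, RCLike.norm_ofNat]
    gcongr
    exact (norm_add_le _ _).trans (by gcongr)
  calc ‖(b + c - 1) / 2‖ * r ≤ (‖b‖ + ‖c‖) / 2 * r := by gcongr
    _ = (‖b‖ * r + r * ‖c‖) / 2 := by ring
    _ ≤ (‖b‖ * ‖c‖ + ‖b‖ * ‖c‖) / 2 := by gcongr
    _ = ‖b‖ * ‖c‖ := add_self_div_two _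

theorem norm_eval_ascPochhammer_half_add_sub_one_mul_le {b c : ℂ} {r : ℝ} (hr : 1 / 2 ≤ r)
    (hb : r ≤ b.re) (hc : r ≤ c.re) (n : ℕ) :
    ‖(ascPochhammer ℂ n).eval ((b + c - 1) / 2)‖ * ‖(ascPochhammer ℂ n).eval (r : ℂ)‖ ≤
      ‖(ascPochhammer ℂ n).eval b‖ * ‖(ascPochhammer ℂ n).eval c‖ := by
  induction n with
  | zero => simp
  | succ n ih =>
    have hstep : ‖(b + c - 1) / 2 + n‖ * ‖(r : ℂ) + n‖ ≤ ‖b + n‖ * ‖c + n‖ := by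
      have hrn : ‖(r : ℂ) + n‖ = r + n := by
        rw [← ofReal_natCast, ← ofReal_add, Complex.norm_of_nonneg (by positivity)]
      rw [hrn, show (b + c - 1) / 2 + (n : ℂ) = (b + n + (c + n) - 1) / 2 by ring]
      exact norm_half_add_sub_one_mul_le (by linarith [n.cast_nonneg (α := ℝ)])
        (by simpa using hb) (by simpa using hc)
    simp only [ascPochhammer_succ_eval, norm_mul]
    rw [mul_mul_mul_comm, mul_mul_mul_comm ‖(ascPochhammer ℂ n).eval b‖]
    exact mul_le_mul ih hstep (by positivity) (by positivity)

theorem norm_hypergeometricTerm_half_add_sub_one_le (as : List ℂ) (z : ℂ) {b c : ℂ} {r : ℝ}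
    (hr : 1 / 2 ≤ r) (hb : r ≤ b.re) (hc : r ≤ c.re) (n : ℕ) :
    ‖hypergeometricTerm (as ++ [(b + c - 1) / 2]) [b, c] z n‖ ≤
      ‖hypergeometricTerm as [(r : ℂ)] z n‖ := by
  have hr0 : 0 < r := by linarith
  have hpos {x : ℂ} (hx : 0 < x.re) : 0 < ‖(ascPochhammer ℂ n).eval x‖ :=
    norm_pos_iff.2 (eval_ascPochhammer_ne_zero (ne_neg_natCast_of_re_pos hx) n)
  have hbpos := hpos (hr0.trans_le hb)
  have hcpos := hpos (hr0.trans_le hc)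
  have hrpos := hpos (x := r) (by simpa using hr0)
  simp only [hypergeometricTerm, List.map_append, List.prod_append, List.map_cons, List.map_nil,
    List.prod_cons, List.prod_nil, mul_one, norm_mul, norm_div, norm_natCast]
  gcongr ?_ * _
  rw [div_le_div_iff₀ (by positivity) (by positivity), mul_assoc,
    mul_left_comm _ (n.factorial : ℝ)]
  gcongr _ * (_ * ?_)
  exact norm_eval_ascPochhammer_half_add_sub_one_mul_le hr hb hc n

theorem tendsto_hypergeometricTerm_ofReal_atTop (as : List ℂ) (z : ℂ) {n : ℕ} (hn : n ≠ 0) :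
    Tendsto (fun r : ℝ => hypergeometricTerm as [(r : ℂ)] z n) atTop (𝓝 0) := by
  have hdeg : 0 < (ascPochhammer ℂ n).degree :=
    Polynomial.natDegree_pos_iff_degree_pos.1
      (by rwa [ascPochhammer_natDegree, Nat.pos_iff_ne_zero])
  have hnorm : Tendsto (fun r : ℝ => ‖(r : ℂ)‖) atTop atTop := by
    simpa using tendsto_abs_atTop_atTop
  have hinv : Tendsto (fun r : ℝ => ((ascPochhammer ℂ n).eval (r : ℂ))⁻¹) atTop (𝓝 0) :=
    tendsto_inv₀_cobounded.comp (tendsto_norm_atTop_iff_cobounded.1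
      ((ascPochhammer ℂ n).tendsto_norm_atTop hdeg hnorm))
  have hlim := hinv.const_mul
    ((as.map fun a => (ascPochhammer ℂ n).eval a).prod / n.factorial * z ^ n)
  rw [mul_zero] at hlim
  refine hlim.congr fun r => ?_
  simp only [hypergeometricTerm, List.map_cons, List.map_nil, List.prod_cons, List.prod_nil,
    mul_one, div_eq_mul_inv, mul_inv]
  ring

theorem tendsto_hypergeometricTerm_half_add_sub_one {ι : Type*} {l : Filter ι} {b c : ι → ℂ}
    (hb : Tendsto (fun i => (b i).re) l atTop) (hc : Tendsto (fun i => (c i).re) l atTop)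
    (as : List ℂ) (z : ℂ) {n : ℕ} (hn : n ≠ 0) :
    Tendsto (fun i => hypergeometricTerm (as ++ [(b i + c i - 1) / 2]) [b i, c i] z n) l
      (𝓝 0) := by
  have hmin : Tendsto (fun i => min (b i).re (c i).re) l atTop :=
    tendsto_atTop.2 fun r => by
      filter_upwards [hb.eventually_ge_atTop r, hc.eventually_ge_atTop r] with i using le_min
  have hlim := ((tendsto_hypergeometricTerm_ofReal_atTop as z hn).comp hmin).norm
  rw [norm_zero] at hlim
  refine squeeze_zero_norm' ?_ hlim
  filter_upwards [hmin.eventually_ge_atTop (1 / 2)] with i hi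
  exact norm_hypergeometricTerm_half_add_sub_one_le as z hi (min_le_left _ _) (min_le_right _ _) n

/-- Tannery's theorem: once `b` and `c` have real parts at least `r`, the terms are dominated by
those of the convergent series `₂F₁(as; r; 1)`. -/
theorem tendsto_generalizedHypergeometric_half_add_sub_one {ι : Type*} {l : Filter ι} {b c : ι → ℂ}
    (hb : Tendsto (fun i => (b i).re) l atTop) (hc : Tendsto (fun i => (c i).re) l atTop)
    {as : List ℂ} (has : as.length = 2) :
    Tendsto (fun i => generalizedHypergeometric (as ++ [(b i + c i - 1) / 2]) [b i, c i] 1) l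
      (𝓝 1) := by
  obtain ⟨r, hr, hre⟩ : ∃ r : ℝ, 1 / 2 ≤ r ∧ as.sum.re < r :=
    ⟨max (1 / 2) (as.sum.re + 1), le_max_left _ _, lt_max_of_lt_right (lt_add_one _)⟩
  have hsummable : Summable (hypergeometricTerm as [(r : ℂ)] 1) :=
    summable_hypergeometricTerm_one has
      (by simpa using ne_neg_natCast_of_re_pos (x := r) (by rw [ofReal_re]; linarith))
      (by simpa using hre)
  have hlim : Tendsto
      (fun i => generalizedHypergeometric (as ++ [(b i + c i - 1) / 2]) [b i, c i] 1) l
      (𝓝 (∑' n : ℕ, if n = 0 then 1 else 0)) := by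
    refine tendsto_tsum_of_dominated_convergence hsummable.norm (fun n => ?_) ?_
    · rcases eq_or_ne n 0 with rfl | hn
      · simp [hypergeometricTerm, tendsto_const_nhds]
      · simpa only [if_neg hn] using tendsto_hypergeometricTerm_half_add_sub_one hb hc as 1 hn
    · filter_upwards [hb.eventually_ge_atTop r, hc.eventually_ge_atTop r] with i hbi hci
      exact norm_hypergeometricTerm_half_add_sub_one_le as 1 hr hbi hci
  rwa [tsum_ite_eq] at hlim

end LargeLowerParameters

section WhippleSeries

/-- The `n`-th term of Whipple's series `₃F₂(a, 1 - a, (b + c - 1) / 2; b, c; 1)`. -/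
noncomputable def whippleTerm (a b c : ℂ) : ℕ → ℂ :=
  hypergeometricTerm [a, 1 - a, (b + c - 1) / 2] [b, c] 1

/-- The sum of Whipple's series `₃F₂(a, 1 - a, (b + c - 1) / 2; b, c; 1)`. -/
noncomputable def whippleSum (a b c : ℂ) : ℂ :=
  generalizedHypergeometric [a, 1 - a, (b + c - 1) / 2] [b, c] 1

theorem whippleSum_comm (a b c : ℂ) : whippleSum a b c = whippleSum a c b := by
  refine tsum_congr fun n => ?_
  simp only [hypergeometricTerm, List.map_cons, List.map_nil, List.prod_cons, List.prod_nil,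
    add_comm b c]
  ring

section Convergence

variable {b c : ℂ}

theorem whipple_lower_ne_neg_natCast (hb : ∀ k : ℕ, b ≠ -k) (hc : ∀ k : ℕ, c ≠ -k) :
    ∀ x ∈ [b, c], ∀ k : ℕ, x ≠ -k := by
  simpa using ⟨hb, hc⟩

theorem whipple_sum_upper_re_lt_sum_lower_re (a : ℂ) (hbc : 1 < (b + c).re) :
    [a, 1 - a, (b + c - 1) / 2].sum.re < [b, c].sum.re := by
  simp only [List.sum_cons, List.sum_nil, add_zero, add_sub_cancel, ← add_assoc, add_re, sub_re,
    one_re, div_ofNat_re] at hbc ⊢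
  linarith

theorem summable_whippleTerm (a : ℂ) (hbc : 1 < (b + c).re) (hb : ∀ k : ℕ, b ≠ -k)
    (hc : ∀ k : ℕ, c ≠ -k) : Summable (whippleTerm a b c) :=
  summable_hypergeometricTerm_one rfl (whipple_lower_ne_neg_natCast hb hc)
    (whipple_sum_upper_re_lt_sum_lower_re a hbc)

theorem tendsto_natCast_mul_whippleTerm (a : ℂ) (hbc : 1 < (b + c).re) (hb : ∀ k : ℕ, b ≠ -k)
    (hc : ∀ k : ℕ, c ≠ -k) : Tendsto (fun n : ℕ => n * whippleTerm a b c n) atTop (𝓝 0) :=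
  tendsto_natCast_mul_hypergeometricTerm_one rfl (whipple_lower_ne_neg_natCast hb hc)
    (whipple_sum_upper_re_lt_sum_lower_re a hbc)

end Convergence

theorem whippleTerm_succ (a b c : ℂ) (n : ℕ) :
    whippleTerm a b c (n + 1) = (a + n) * (1 - a + n) * ((b + c - 1) / 2 + n) /
      ((n + 1) * ((b + n) * (c + n))) * whippleTerm a b c n := by
  simp [whippleTerm, hypergeometricTerm_succ, mul_assoc]

theorem whippleTerm_add_two (a : ℂ) {b c : ℂ} (hbc : b + c ≠ 1) (hb : ∀ k : ℕ, b ≠ -k) (n : ℕ) :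
    whippleTerm a (b + 2) c n = b * (b + 1) * ((b + c - 1) / 2 + n) /
      ((b + c - 1) / 2 * ((b + n) * (b + n + 1))) * whippleTerm a b c n := by
  have hs : (b + c - 1) / 2 ≠ 0 := div_ne_zero (sub_ne_zero.2 hbc) two_ne_zero
  have hb0 : b ≠ 0 := by simpa using add_natCast_ne_zero hb 0
  have hb1 : b + 1 ≠ 0 := by simpa using add_natCast_ne_zero hb 1
  have hbn := add_natCast_ne_zero hb n
  have hbn1 : b + n + 1 ≠ 0 := by simpa [add_assoc] using add_natCast_ne_zero hb (n + 1)
  have hupper : (ascPochhammer ℂ n).eval ((b + c - 1) / 2 + 1) =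
      (ascPochhammer ℂ n).eval ((b + c - 1) / 2) * ((b + c - 1) / 2 + n) / ((b + c - 1) / 2) :=
    (eq_div_iff hs).2 ((mul_comm _ _).trans (mul_eval_ascPochhammer_add_one n _))
  have hlower : (ascPochhammer ℂ n).eval (b + 2) =
      (ascPochhammer ℂ n).eval b * (b + n) * (b + n + 1) / (b * (b + 1)) := by
    have hshift := mul_eval_ascPochhammer_add_one n (b + 1)
    rw [add_assoc, one_add_one_eq_two] at hshift
    rw [eq_div_iff (mul_ne_zero hb0 hb1), ← mul_eval_ascPochhammer_add_one]
    linear_combination b * hshift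
  have hs_add : (b + 2 + c - 1) / 2 = (b + c - 1) / 2 + 1 := by ring
  simp only [whippleTerm, hypergeometricTerm, List.map_cons, List.map_nil, List.prod_cons,
    List.prod_nil, hs_add, hupper, hlower]
  generalize (b + c - 1) / 2 = s at hs ⊢
  field_simp

/-- The rational multiple of Whipple's term whose forward difference is the termwise error of the
contiguous relation `b ↦ b + 2`, so that summing the error telescopes. -/
noncomputable def whippleCertificate (a b c : ℂ) (n : ℕ) : ℂ :=
  n * (c + n - 1) / ((b + c - 1) / 2 * (b + n)) * whippleTerm a b c n

theorem whippleTerm_add_two_sub (a : ℂ) {b c : ℂ} (hbc : b + c ≠ 1) (hb : ∀ k : ℕ, b ≠ -k)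
    (hc : ∀ k : ℕ, c ≠ -k) (n : ℕ) :
    (b + a) * (b + (1 - a)) / (b * (b + 1)) * whippleTerm a (b + 2) c n - whippleTerm a b c n =
      whippleCertificate a b c (n + 1) - whippleCertificate a b c n := by
  obtain ⟨s, hs⟩ : ∃ s, s = (b + c - 1) / 2 := ⟨_, rfl⟩
  have hs0 : s ≠ 0 := hs ▸ div_ne_zero (sub_ne_zero.2 hbc) two_ne_zero
  have hc_eq : c = 2 * s + 1 - b := by rw [hs]; ring
  have hb0 : b ≠ 0 := by simpa using add_natCast_ne_zero hb 0
  have hb1 : b + 1 ≠ 0 := by simpa using add_natCast_ne_zero hb 1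
  have hbn := add_natCast_ne_zero hb n
  have hbn1 : b + n + 1 ≠ 0 := by simpa [add_assoc] using add_natCast_ne_zero hb (n + 1)
  have hcn := add_natCast_ne_zero hc n
  have hn1 : (n : ℂ) + 1 ≠ 0 := n.cast_add_one_ne_zero
  rw [whippleCertificate, whippleCertificate, whippleTerm_add_two a hbc hb, whippleTerm_succ,
    ← hs, Nat.cast_succ, ← add_assoc b, ← add_assoc c, add_sub_cancel_right]
  field_simp
  rw [hc_eq]
  ring

theorem tendsto_whippleCertificate (a : ℂ) {b c : ℂ} (hbc : 1 < (b + c).re)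
    (hb : ∀ k : ℕ, b ≠ -k) (hc : ∀ k : ℕ, c ≠ -k) :
    Tendsto (whippleCertificate a b c) atTop (𝓝 0) := by
  have hratio : Tendsto (fun n : ℕ => (c - 1 + 1 * n) / (b + 1 * n)) atTop (𝓝 (1 / 1)) :=
    tendsto_add_mul_div_add_mul_atTop_nhds _ _ _ one_ne_zero
  have hlim := ((tendsto_natCast_mul_whippleTerm a hbc hb hc).mul hratio).div_const
    ((b + c - 1) / 2)
  rw [zero_mul, zero_div] at hlim
  refine hlim.congr fun n => ?_
  simp only [whippleCertificate, one_mul, div_eq_mul_inv, mul_inv]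
  ring

theorem one_lt_add_two_mul_natCast_add_re {b c : ℂ} (hbc : 1 < (b + c).re) (N : ℕ) :
    1 < (b + 2 * N + c).re := by
  simp only [add_re, mul_re, re_ofNat, im_ofNat, natCast_re, natCast_im, mul_zero, sub_zero]
    at hbc ⊢
  linarith [N.cast_nonneg (α := ℝ)]

theorem whippleSum_eq_mul_add_two (a : ℂ) {b c : ℂ} (hbc : 1 < (b + c).re)
    (hb : ∀ k : ℕ, b ≠ -k) (hc : ∀ k : ℕ, c ≠ -k) :
    whippleSum a b c =
      (b + a) * (b + (1 - a)) / (b * (b + 1)) * whippleSum a (b + 2) c := by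
  have hbc_ne : b + c ≠ 1 := fun h => by simp [h] at hbc
  have hbc_add_two : 1 < (b + 2 + c).re := by
    simpa using one_lt_add_two_mul_natCast_add_re hbc 1
  have hpartial (N : ℕ) : (b + a) * (b + (1 - a)) / (b * (b + 1)) *
      ∑ n ∈ Finset.range N, whippleTerm a (b + 2) c n - ∑ n ∈ Finset.range N, whippleTerm a b c n =
        whippleCertificate a b c N := by
    rw [Finset.mul_sum, ← Finset.sum_sub_distrib,
      Finset.sum_congr rfl fun n _ => whippleTerm_add_two_sub a hbc_ne hb hc n,
      Finset.sum_range_sub, sub_eq_self]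
    simp [whippleCertificate]
  have hb_add_two : ∀ k : ℕ, b + 2 ≠ -k := mod_cast add_natCast_ne_neg_natCast hb 2
  have hsum := (summable_whippleTerm a hbc hb hc).hasSum.tendsto_sum_nat
  have hsum_add_two := (summable_whippleTerm a hbc_add_two hb_add_two hc).hasSum.tendsto_sum_nat
  have hlim := ((hsum_add_two.const_mul _).sub hsum).congr hpartial
  exact (sub_eq_zero.1 (tendsto_nhds_unique hlim (tendsto_whippleCertificate a hbc hb hc))).symm

/-- The factor by which Whipple's sum changes when its lower parameter `b` is raised by `2 * N`. -/
noncomputable def whippleFactor (a b : ℂ) (N : ℕ) : ℂ :=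
  ascPochhammerProd [(b + a) / 2, (b + (1 - a)) / 2] N / ascPochhammerProd [b / 2, (b + 1) / 2] N

theorem whippleFactor_succ (a b : ℂ) (N : ℕ) :
    whippleFactor a b (N + 1) = whippleFactor a b N *
      ((b + 2 * N + a) * (b + 2 * N + (1 - a)) / ((b + 2 * N) * (b + 2 * N + 1))) := by
  have hshift : b / 2 + N = (b + 2 * N) / 2 := by ring
  have hshift_add (x : ℂ) : (b + x) / 2 + N = (b + 2 * N + x) / 2 := by ring
  simp only [whippleFactor, ascPochhammerProd, List.map_cons, List.map_nil, List.prod_cons,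
    List.prod_nil, mul_one, ascPochhammer_succ_eval, hshift, hshift_add]
  rw [mul_mul_mul_comm, mul_mul_mul_comm (Polynomial.eval (b / 2) _), mul_div_mul_comm,
    div_mul_div_comm _ 2, div_mul_div_comm _ 2,
    div_div_div_cancel_right₀ (mul_ne_zero two_ne_zero two_ne_zero)]

theorem whippleSum_eq_whippleFactor_mul (a : ℂ) {b c : ℂ} (hbc : 1 < (b + c).re)
    (hb : ∀ k : ℕ, b ≠ -k) (hc : ∀ k : ℕ, c ≠ -k) (N : ℕ) :
    whippleSum a b c = whippleFactor a b N * whippleSum a (b + 2 * N) c := by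
  induction N with
  | zero => simp [whippleFactor, ascPochhammerProd]
  | succ N ih =>
    have hb_add : ∀ k : ℕ, b + 2 * N ≠ -k := mod_cast add_natCast_ne_neg_natCast hb (2 * N)
    rw [ih, whippleSum_eq_mul_add_two a (one_lt_add_two_mul_natCast_add_re hbc N) hb_add hc,
      whippleFactor_succ, mul_assoc, Nat.cast_succ, mul_add_one (2 : ℂ), ← add_assoc b (2 * N) 2]

theorem whippleSum_eq_whippleFactor_mul_whippleFactor_mul (a : ℂ) {b c : ℂ} (hbc : 1 < (b + c).re)
    (hb : ∀ k : ℕ, b ≠ -k) (hc : ∀ k : ℕ, c ≠ -k) (N : ℕ) :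
    whippleSum a b c =
      whippleFactor a b N * whippleFactor a c N * whippleSum a (b + 2 * N) (c + 2 * N) := by
  have hb_add : ∀ k : ℕ, b + 2 * N ≠ -k := mod_cast add_natCast_ne_neg_natCast hb (2 * N)
  have hcb := one_lt_add_two_mul_natCast_add_re hbc N
  rw [add_comm] at hcb
  rw [whippleSum_eq_whippleFactor_mul a hbc hb hc N, whippleSum_comm,
    whippleSum_eq_whippleFactor_mul a hcb hc hb_add N, whippleSum_comm, mul_assoc]

theorem tendsto_whippleFactor (a : ℂ) {b : ℂ} (hb : ∀ k : ℕ, b ≠ -k) :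
    Tendsto (whippleFactor a b) atTop
      (𝓝 (2 ^ (1 - b) * √Real.pi * Gamma b /
        (Gamma ((b + a) / 2) * Gamma ((b + (1 - a)) / 2)))) := by
  have hlower : ∀ x ∈ [b / 2, (b + 1) / 2], ∀ k : ℕ, x ≠ -k := by
    simp only [List.forall_mem_cons, List.not_mem_nil, false_imp_iff, implies_true, and_true]
    refine ⟨fun k h => hb (2 * k) ?_, fun k h => hb (2 * k + 1) ?_⟩ <;> push_cast <;>
      linear_combination 2 * h
  have hbalanced : [b / 2, (b + 1) / 2].sum - [(b + a) / 2, (b + (1 - a)) / 2].sum = 0 := by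
    simp only [List.sum_cons, List.sum_nil]
    ring
  have hlim := tendsto_ascPochhammerProd_div (as := [(b + a) / 2, (b + (1 - a)) / 2])
    (bs := [b / 2, (b + 1) / 2]) rfl hlower
  have hduplication := Gamma_mul_Gamma_add_half (b / 2)
  rw [← add_div, mul_div_cancel₀ b two_ne_zero] at hduplication
  simp only [hbalanced, cpow_zero, one_mul, List.map_cons, List.map_nil, List.prod_cons,
    List.prod_nil, mul_one, hduplication] at hlim
  rwa [mul_right_comm, mul_comm _ (Gamma b)]

theorem tendsto_whippleSum_add_two_mul (a b c : ℂ) :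
    Tendsto (fun N : ℕ => whippleSum a (b + 2 * N) (c + 2 * N)) atTop (𝓝 1) := by
  have hre (x : ℂ) : Tendsto (fun N : ℕ => (x + 2 * N).re) atTop atTop := by
    simpa using tendsto_atTop_add_const_left _ x.re
      (tendsto_natCast_atTop_atTop.const_mul_atTop (zero_lt_two' ℝ))
  exact tendsto_generalizedHypergeometric_half_add_sub_one (hre b) (hre c) (as := [a, 1 - a]) rfl

theorem two_cpow_mul_sqrt_pi_mul (b c : ℂ) :
    2 ^ (1 - b) * √Real.pi * (2 ^ (1 - c) * √Real.pi) = 4 * Real.pi * (2 : ℂ) ^ (-(b + c)) := by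
  have hsqrt : (√Real.pi : ℂ) * √Real.pi = Real.pi := by
    rw [← ofReal_mul, Real.mul_self_sqrt Real.pi_pos.le]
  have hpow : (2 : ℂ) ^ (1 - b) * 2 ^ (1 - c) = 4 * 2 ^ (-(b + c)) := by
    rw [← cpow_add _ _ two_ne_zero, show 1 - b + (1 - c) = (2 : ℕ) + -(b + c) by push_cast; ring,
      cpow_add _ _ two_ne_zero, cpow_natCast]
    norm_num
  rw [mul_mul_mul_comm, hpow, hsqrt, mul_right_comm]

end WhippleSeries

theorem mainTheorem6 (a b c : ℂ) (hbc : 1 < (b + c).re)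
    (hb : ∀ k : ℕ, b ≠ -(k : ℂ)) (hc : ∀ k : ℕ, c ≠ -(k : ℂ)) :
    Summable (hypergeometricTerm [a, 1 - a, (b + c - 1) / 2] [b, c] 1) ∧
    generalizedHypergeometric [a, 1 - a, (b + c - 1) / 2] [b, c] 1 =
      (4 * (Real.pi : ℂ) * (2 : ℂ) ^ (-(b + c)) * Complex.Gamma b * Complex.Gamma c) /
        (Complex.Gamma ((b + a) / 2) * Complex.Gamma ((b + (1 - a)) / 2) *
          Complex.Gamma ((c + a) / 2) * Complex.Gamma ((c + (1 - a)) / 2)) := by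
  refine ⟨summable_whippleTerm a hbc hb hc, ?_⟩
  have hlim := ((tendsto_whippleFactor a hb).mul (tendsto_whippleFactor a hc)).mul
    (tendsto_whippleSum_add_two_mul a b c)
  have hconst : Tendsto (fun _ : ℕ => whippleSum a b c) atTop (𝓝 (whippleSum a b c)) :=
    tendsto_const_nhds
  have hiterate := whippleSum_eq_whippleFactor_mul_whippleFactor_mul a hbc hb hc
  refine (tendsto_nhds_unique (hconst.congr hiterate) hlim).trans ?_
  rw [mul_one, div_mul_div_comm, mul_mul_mul_comm _ (Gamma b), two_cpow_mul_sqrt_pi_mul,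
    ← mul_assoc, ← mul_assoc]
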